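/- Let $n\ge 1$ and let $u\in\mathbb{Z}^n$ have positive entries; put $B_u=\{x\in\mathbb{Z}^n : 0\le x_i\le u_i \text{ for } i=1,\dots,n\}$. For integer vectors write $x\preceq y$ (equivalently $y\succeq x$) if $x=y$ or $x_i<y_i$ at the largest index $i$ with $x_i\ne y_i$. A vector $a\in\mathbb{Z}^n$ with strictly positive entries is called superincreasing (with respect to $u$) if $\sum_{k<i}a_ku_k\le a_i$ for all $i=2,\dots,n$. For superincreasing $a,w$ and positive integers $b,d$ define the superincreasing knapsacks $$K^{\le}=\{x\in B_u : a^{\top}x\le b\},\qquad K^{\ge}=\{x\in B_u : w^{\top}x\ge d\},$$ and the vectors $\theta,\gamma$, recursively for $i=n,n-1,\dots,1$, by $$\theta_i=\min\Bigl\{u_i,\Bigl\lfloor\tfrac{b-\sum_{k>i}a_k\theta_k}{a_i}\Bigr\rfloor\Bigr\},\qquad \gamma_i=u_i-\min\Bigl\{u_i,\Bigl\lfloor\tfrac{w^{\top}u-d-\sum_{k>i}w_k(u_k-\gamma_k)}{w_i}\Bigr\rfloor\Bigr\}.$$ (1) For any $\gamma,\theta\in B_u$, $$\operatorname{conv}\{x\in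 B_u:\gamma\preceq x\preceq\theta\}=\operatorname{conv}\{x\in B_u: x\succeq\gamma\}\cap\operatorname{conv}\{x\in B_u: x\preceq\theta\}.$$ (2) For superincreasing $a,w$ with strictly positive integer entries and positive integers $b,d$, with $\theta,\gamma$ as defined above, $K^{\le}=\{x\in B_u:x\preceq\theta\}$, $K^{\ge}=\{x\in B_u:x\succeq\gamma\}$, and $$\operatorname{conv}(K^{\le}\cap K^{\ge})=\operatorname{conv}(K^{\le})\cap\operatorname{conv}(K^{\ge}).$$ (3) There is an absolute constant $C$ such that for every $n\ge1$ and every $u$ as above, the convex hull of the intersection of any nonempty finite family of superincreasing knapsacks over $B_u$, each of $\le$- or $\ge$-type, with strictly positive integer weights and a positive integer right-hand side (the weights and right-hand sides may differ between the knapsacks), is the solution set in $\mathbb{R}^n$ of a system of at most $Cn$ linear inequalities; in particular the number of inequalities is $O(n)$ independently of the number of knapsacks. -/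

import Mathlib

namespace SuperincreasingKnapsack

/-- The discrete box of all integer vectors `x` with `0 ≤ x i ≤ u i` for every `i`. -/
def box {n : ℕ} (u : Fin n → ℤ) : Set (Fin n → ℤ) := {x | ∀ i, 0 ≤ x i ∧ x i ≤ u i}

/-- The sequence of pairs `(a i, u i)` is weakly superincreasing. For the first index the sum is
empty, so that nothing beyond `0 ≤ a i` is asked there. -/
def Superincreasing {n : ℕ} (a u : Fin n → ℤ) : Prop :=
  ∀ i, ∑ k ∈ Finset.Iio i, a k * u k ≤ a i

/-- The knapsack `a ⬝ᵥ x ≤ b` over the box. -/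
def knapsackLE {n : ℕ} (a u : Fin n → ℤ) (b : ℤ) : Set (Fin n → ℤ) := {x ∈ box u | a ⬝ᵥ x ≤ b}

/-- The knapsack `w ⬝ᵥ x ≥ d` over the box. -/
def knapsackGE {n : ℕ} (w u : Fin n → ℤ) (d : ℤ) : Set (Fin n → ℤ) := {x ∈ box u | d ≤ w ⬝ᵥ x}

/-- The lexicographic order that compares the entries starting from the last one: `x = y`, or
`x i < y i` at the largest index `i` with `x i ≠ y i`. -/
def LexLE {n : ℕ} (x y : Fin n → ℤ) : Prop := toColex x ≤ toColex y

/-- `LexLE` spelled out in coordinates. -/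
theorem lexLE_iff {n : ℕ} (x y : Fin n → ℤ) :
    LexLE x y ↔ x = y ∨ ∃ i, x i < y i ∧ ∀ j, i < j → x j = y j := by
  unfold LexLE
  rw [le_iff_eq_or_lt, toColex_inj]
  refine or_congr Iff.rfl ?_
  constructor
  · rintro ⟨i, h, hi⟩
    exact ⟨i, hi, fun j hj => h j hj⟩
  · rintro ⟨i, hi, h⟩
    exact ⟨i, fun j hj => h j hj, hi⟩

/-- The greedy solution of the knapsack `a ⬝ᵥ x ≤ b` over the box, computed from the last index
down to the first one; `/` is division of integers rounded down (for positive divisors). -/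
def greedy {n : ℕ} (a u : Fin n → ℤ) (b : ℤ) (i : Fin n) : ℤ :=
  min (u i) ((b - ∑ k : {k : Fin n // i < k}, a k * greedy a u b k) / a i)
termination_by n - (i : ℕ)
decreasing_by
  have _h1 : (i : ℕ) < ((k : Fin n) : ℕ) := k.2
  have _h2 : ((k : Fin n) : ℕ) < n := (k : Fin n).2
  omega

/-- The minimal packing of the knapsack `w ⬝ᵥ x ≥ d` over the box: the greedy solution after
complementing the variables, `x ↦ u - x`. -/
def minPacking {n : ℕ} (w u : Fin n → ℤ) (d : ℤ) (i : Fin n) : ℤ :=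
  u i - greedy w u (w ⬝ᵥ u - d) i

/-- The convex hull in `ℝ ^ n` of a set of integer vectors. -/
def conv {n : ℕ} (S : Set (Fin n → ℤ)) : Set (Fin n → ℝ) :=
  convexHull ℝ ((fun (x : Fin n → ℤ) (i : Fin n) => (x i : ℝ)) '' S)

/-- `P` is the solution set of a system of at most `N` linear inequalities `A k ⬝ᵥ x ≤ r k`. -/
def DescribedBy {n : ℕ} (P : Set (Fin n → ℝ)) (N : ℕ) : Prop :=
  ∃ m ≤ N, ∃ (A : Fin m → Fin n → ℝ) (r : Fin m → ℝ), P = {x | ∀ k, A k ⬝ᵥ x ≤ r k}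

end SuperincreasingKnapsack

/-
Comparing vectors from the last entry on, a vector is below `θ` iff it agrees with `θ` down to some
index, is smaller there, and is free in the box below that index. So a point `x` of the hull of the
vectors below `θ` is an average in which only a part of the mass is still tied with `θ` after the
entries `n, …, i` have been read; the least possible tied mass is `max 0` of an affine function of
`x`, and `x` lies in the hull iff `n` affine inequalities, one for each entry, leave room for it.

For the vectors between `γ` and `θ`, the first entry at which `γ` and `θ` differ splits the mass
into a part `α` tied with `θ`, a part `β` tied with `γ`, and a free part `1 - α - β ≥ 0`. From there
on the two tied masses can be chosen minimal independently of each other, so that the inequalities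
for `γ` and those for `θ` together already describe the hull of the interval: this gives the
intersection formula and the linear bound on the number of inequalities at once. A superincreasing
knapsack is the set of all vectors of the box below its greedy solution, or above its minimal
packing, so that every intersection of knapsacks is an interval.
-/

namespace SuperincreasingKnapsack

open Set
open scoped Pointwise

/-- The initial segment of the box below `θ` for `LexLE`. -/
def lexIic {n : ℕ} (u θ : Fin n → ℤ) : Set (Fin n → ℤ) := {x ∈ box u | LexLE x θ}

/-- The final segment of the box above `γ` for `LexLE`. -/
def lexIci {n : ℕ} (u γ : Fin n → ℤ) : Set (Fin n → ℤ) := {x ∈ box u | LexLE γ x}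

/-- The interval of the box between `γ` and `θ` for `LexLE`. -/
def lexIcc {n : ℕ} (u γ θ : Fin n → ℤ) : Set (Fin n → ℤ) := {x ∈ box u | LexLE γ x ∧ LexLE x θ}

/-! ### The lexicographic order on the box -/

section LexOrder

variable {n : ℕ} {u x y γ θ : Fin n → ℤ}

theorem LexLE.refl (x : Fin n → ℤ) : LexLE x x := le_refl (toColex x)

theorem LexLE.trans {z : Fin n → ℤ} (hxy : LexLE x y) (hyz : LexLE y z) : LexLE x z :=
  le_trans (α := Colex (Fin n → ℤ)) hxy hyz

theorem exists_lt_of_not_lexLE (h : ¬ LexLE x y) : ∃ i, y i < x i ∧ ∀ j, i < j → y j = x j := by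
  obtain ⟨i, htie, hlt⟩ : toColex y < toColex x := not_le.1 h
  exact ⟨i, hlt, htie⟩

theorem sub_lexLE_sub_left_iff (u x y : Fin n → ℤ) : LexLE (u - x) (u - y) ↔ LexLE y x := by
  simp only [lexLE_iff, Pi.sub_apply, sub_right_inj, sub_lt_sub_iff_left, eq_comm]

theorem lexLE_succ_iff {x y : Fin (n + 1) → ℤ} :
    LexLE x y ↔ x (Fin.last n) < y (Fin.last n) ∨
      x (Fin.last n) = y (Fin.last n) ∧ LexLE (Fin.init x) (Fin.init y) := by
  simp only [lexLE_iff]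
  constructor
  · rintro (rfl | ⟨i, hi, htie⟩)
    · exact Or.inr ⟨rfl, Or.inl rfl⟩
    · induction i using Fin.lastCases with
      | last => exact Or.inl hi
      | cast i =>
        exact Or.inr ⟨htie _ (Fin.castSucc_lt_last i),
          Or.inr ⟨i, hi, fun j hj => htie _ (Fin.castSucc_lt_castSucc_iff.2 hj)⟩⟩
  · rintro (hlt | ⟨hlast, hinit | ⟨i, hi, htie⟩⟩)
    · exact Or.inr ⟨_, hlt, fun j hj => absurd (Fin.le_last j) hj.not_ge⟩
    · left
      rw [← Fin.snoc_init_self x, ← Fin.snoc_init_self y, hinit, hlast]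
    · refine Or.inr ⟨i.castSucc, hi, fun j hj => ?_⟩
      induction j using Fin.lastCases with
      | last => exact hlast
      | cast j => exact htie j (Fin.castSucc_lt_castSucc_iff.1 hj)

theorem box_eq_Icc (u : Fin n → ℤ) : box u = Icc 0 u := by
  ext x
  exact forall_and

theorem finite_box (u : Fin n → ℤ) : (box u).Finite := box_eq_Icc u ▸ finite_Icc 0 u

theorem sub_mem_box_iff : u - x ∈ box u ↔ x ∈ box u := by
  simp only [box_eq_Icc, sub_mem_Icc_zero_iff_right]

theorem sub_mem_lexIic_sub_iff : u - x ∈ lexIic u (u - γ) ↔ x ∈ lexIci u γ :=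
  and_congr sub_mem_box_iff (sub_lexLE_sub_left_iff u x γ)

theorem mem_box_succ_iff {u x : Fin (n + 1) → ℤ} :
    x ∈ box u ↔ Fin.init x ∈ box (Fin.init u) ∧ x (Fin.last n) ∈ Icc 0 (u (Fin.last n)) :=
  Fin.forall_fin_succ'

theorem exists_eq_lexIcc {S : Set (Fin n → ℤ)} (hS : S ⊆ box u) (hne : S.Nonempty)
    (hconv : ∀ x ∈ S, ∀ y ∈ S, ∀ z ∈ box u, LexLE x z → LexLE z y → z ∈ S) :
    ∃ γ ∈ box u, ∃ θ ∈ box u, S = lexIcc u γ θ := by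
  have hfin : S.Finite := (finite_box u).subset hS
  obtain ⟨γ, hγ, hmin⟩ := exists_min_image S toColex hfin hne
  obtain ⟨θ, hθ, hmax⟩ := exists_max_image S toColex hfin hne
  refine ⟨γ, hS hγ, θ, hS hθ, Subset.antisymm (fun x hx => ⟨hS hx, hmin x hx, hmax x hx⟩) ?_⟩
  exact fun x hx => hconv γ hγ θ hθ x hx.1 hx.2.1 hx.2.2

end LexOrder

section LastEntry

variable {n : ℕ} {u z γ θ : Fin (n + 1) → ℤ}

theorem mem_lexIic_of_last_eq (hθ : θ ∈ box u)
    (hinit : Fin.init z ∈ lexIic (Fin.init u) (Fin.init θ))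
    (hlast : z (Fin.last n) = θ (Fin.last n)) : z ∈ lexIic u θ :=
  ⟨mem_box_succ_iff.2 ⟨hinit.1, hlast ▸ hθ (Fin.last n)⟩,
    lexLE_succ_iff.2 (Or.inr ⟨hlast, hinit.2⟩)⟩

theorem mem_lexIic_of_last_lt (hθ : θ ∈ box u) (hinit : Fin.init z ∈ box (Fin.init u))
    (hnonneg : 0 ≤ z (Fin.last n)) (hlast : z (Fin.last n) < θ (Fin.last n)) : z ∈ lexIic u θ :=
  ⟨mem_box_succ_iff.2 ⟨hinit, hnonneg, hlast.le.trans (hθ (Fin.last n)).2⟩,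
    lexLE_succ_iff.2 (Or.inl hlast)⟩

theorem mem_lexIci_of_last_eq (hγ : γ ∈ box u)
    (hinit : Fin.init z ∈ lexIci (Fin.init u) (Fin.init γ))
    (hlast : z (Fin.last n) = γ (Fin.last n)) : z ∈ lexIci u γ :=
  ⟨mem_box_succ_iff.2 ⟨hinit.1, hlast ▸ hγ (Fin.last n)⟩,
    lexLE_succ_iff.2 (Or.inr ⟨hlast.symm, hinit.2⟩)⟩

theorem mem_lexIci_of_lt_last (hγ : γ ∈ box u) (hinit : Fin.init z ∈ box (Fin.init u))
    (hlast : γ (Fin.last n) < z (Fin.last n)) (hle : z (Fin.last n) ≤ u (Fin.last n)) :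
    z ∈ lexIci u γ :=
  ⟨mem_box_succ_iff.2 ⟨hinit, (hγ (Fin.last n)).1.trans hlast.le, hle⟩,
    lexLE_succ_iff.2 (Or.inl hlast)⟩

end LastEntry

/-! ### Superincreasing knapsacks as lexicographic segments -/

section Knapsack

variable {n : ℕ} {u a w : Fin n → ℤ} {b d : ℤ}

theorem greedy_eq (a u : Fin n → ℤ) (b : ℤ) (i : Fin n) :
    greedy a u b i = min (u i) ((b - ∑ k ∈ Finset.Ioi i, a k * greedy a u b k) / a i) := by
  rw [greedy, ← Finset.sum_subtype (Finset.Ioi i) (fun k => Finset.mem_Ioi)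
    fun k => a k * greedy a u b k]

theorem sum_Ici_mul_greedy_le {i : Fin n} (ha : 0 < a i) :
    ∑ k ∈ Finset.Ici i, a k * greedy a u b k ≤ b := by
  have hle : greedy a u b i ≤ (b - ∑ k ∈ Finset.Ioi i, a k * greedy a u b k) / a i := by
    rw [greedy_eq]
    exact min_le_right _ _
  rw [← Finset.add_sum_Ioi_eq_sum_Ici]
  linarith [(Int.le_ediv_iff_mul_le ha).1 hle]

theorem dotProduct_greedy_le (hn : 0 < n) (ha : ∀ i, 0 < a i) : a ⬝ᵥ greedy a u b ≤ b := by
  obtain ⟨m, rfl⟩ := Nat.exists_eq_add_one.2 hn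
  simpa [dotProduct, ← bot_eq_zero] using sum_Ici_mul_greedy_le (u := u) (b := b) (ha 0)

theorem greedy_mem_box (hu : ∀ i, 0 ≤ u i) (ha : ∀ i, 0 < a i) (hb : 0 ≤ b) :
    greedy a u b ∈ box u := by
  intro i
  have hres : ∑ k ∈ Finset.Ioi i, a k * greedy a u b k ≤ b := by
    by_cases hi : IsMax i
    · rw [hi.finsetIoi_eq, Finset.sum_empty]
      exact hb
    · rw [← Finset.Ici_succ_eq_Ioi_of_not_isMax hi]
      exact sum_Ici_mul_greedy_le (ha _)
  rw [greedy_eq]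
  exact ⟨le_min (hu i) (Int.ediv_nonneg (sub_nonneg.2 hres) (ha i).le), min_le_left _ _⟩

theorem dotProduct_eq_sum_Iio_add_sum_Ici (a x : Fin n → ℤ) (i : Fin n) :
    a ⬝ᵥ x = ∑ k ∈ Finset.Iio i, a k * x k + ∑ k ∈ Finset.Ici i, a k * x k := by
  rw [dotProduct, ← Finset.sum_filter_add_sum_filter_not Finset.univ (· < i)]
  simp only [not_lt, Finset.filter_gt_eq_Iio, Finset.filter_le_eq_Ici]

theorem lexLE_greedy_of_dotProduct_le {x : Fin n → ℤ} (ha : ∀ i, 0 < a i) (hx : x ∈ box u)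
    (hxb : a ⬝ᵥ x ≤ b) : LexLE x (greedy a u b) := by
  by_contra hlex
  obtain ⟨i, hlt, htie⟩ := exists_lt_of_not_lexLE hlex
  have hsum : ∑ k ∈ Finset.Ioi i, a k * greedy a u b k = ∑ k ∈ Finset.Ioi i, a k * x k :=
    Finset.sum_congr rfl fun k hk => by rw [htie k (Finset.mem_Ioi.1 hk)]
  have hdiv : (b - ∑ k ∈ Finset.Ioi i, a k * x k) / a i < x i := by
    rw [greedy_eq, min_lt_iff, hsum] at hlt
    exact hlt.resolve_left (hx i).2.not_gt
  have hlow : 0 ≤ ∑ k ∈ Finset.Iio i, a k * x k :=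
    Finset.sum_nonneg fun k _ => mul_nonneg (ha k).le (hx k).1
  rw [dotProduct_eq_sum_Iio_add_sum_Ici a x i, ← Finset.add_sum_Ioi_eq_sum_Ici] at hxb
  linarith [(Int.ediv_lt_iff_lt_mul (ha i)).1 hdiv]

theorem dotProduct_le_of_lexLE_greedy {x : Fin n → ℤ} (hn : 0 < n) (ha : ∀ i, 0 < a i)
    (hs : Superincreasing a u) (hx : x ∈ box u) (hle : LexLE x (greedy a u b)) : a ⬝ᵥ x ≤ b := by
  rcases (lexLE_iff _ _).1 hle with rfl | ⟨i, hlt, htie⟩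
  · exact dotProduct_greedy_le hn ha
  have hsum : ∑ k ∈ Finset.Ioi i, a k * x k = ∑ k ∈ Finset.Ioi i, a k * greedy a u b k :=
    Finset.sum_congr rfl fun k hk => by rw [htie k (Finset.mem_Ioi.1 hk)]
  calc a ⬝ᵥ x
      = ∑ k ∈ Finset.Iio i, a k * x k
          + (a i * x i + ∑ k ∈ Finset.Ioi i, a k * greedy a u b k) := by
        rw [dotProduct_eq_sum_Iio_add_sum_Ici a x i, ← Finset.add_sum_Ioi_eq_sum_Ici, hsum]
    _ ≤ a i + (a i * x i + ∑ k ∈ Finset.Ioi i, a k * greedy a u b k) := by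
        gcongr
        exact (Finset.sum_le_sum fun k _ =>
          mul_le_mul_of_nonneg_left (hx k).2 (ha k).le).trans (hs i)
    _ = a i * (x i + 1) + ∑ k ∈ Finset.Ioi i, a k * greedy a u b k := by ring
    _ ≤ a i * greedy a u b i + ∑ k ∈ Finset.Ioi i, a k * greedy a u b k := by
        gcongr
        exacts [(ha i).le, hlt]
    _ = ∑ k ∈ Finset.Ici i, a k * greedy a u b k := by rw [← Finset.add_sum_Ioi_eq_sum_Ici]
    _ ≤ b := sum_Ici_mul_greedy_le (ha i)

theorem knapsackLE_eq_lexIic (hn : 0 < n) (ha : ∀ i, 0 < a i) (hs : Superincreasing a u) :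
    knapsackLE a u b = lexIic u (greedy a u b) := by
  ext x
  exact and_congr_right fun hx =>
    ⟨lexLE_greedy_of_dotProduct_le ha hx, dotProduct_le_of_lexLE_greedy hn ha hs hx⟩

theorem sub_mem_knapsackLE_iff {x : Fin n → ℤ} :
    u - x ∈ knapsackLE w u (w ⬝ᵥ u - d) ↔ x ∈ knapsackGE w u d := by
  refine and_congr sub_mem_box_iff ?_
  rw [dotProduct_sub, sub_le_sub_iff_left]

theorem knapsackGE_eq_lexIci (hn : 0 < n) (hw : ∀ i, 0 < w i) (hs : Superincreasing w u) :
    knapsackGE w u d = lexIci u (minPacking w u d) := by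
  ext x
  have hmin : greedy w u (w ⬝ᵥ u - d) = u - minPacking w u d := (sub_sub_cancel u _).symm
  rw [← sub_mem_knapsackLE_iff, knapsackLE_eq_lexIic hn hw hs, hmin, sub_mem_lexIic_sub_iff]

theorem greedy_mem_box_of_nonempty (ha : ∀ i, 0 < a i) (hne : (knapsackLE a u b).Nonempty) :
    greedy a u b ∈ box u := by
  obtain ⟨x, hx, hxb⟩ := hne
  exact greedy_mem_box (fun i => (hx i).1.trans (hx i).2) ha
    ((Finset.sum_nonneg fun i _ => mul_nonneg (ha i).le (hx i).1).trans hxb)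

theorem minPacking_mem_box_of_nonempty (hw : ∀ i, 0 < w i) (hne : (knapsackGE w u d).Nonempty) :
    minPacking w u d ∈ box u :=
  sub_mem_box_iff.2 <| greedy_mem_box_of_nonempty hw <|
    hne.imp' (u - ·) fun _ => sub_mem_knapsackLE_iff.2

end Knapsack

/-! ### Hulls of integer sets -/

/-- The integer vector `z` as a point of `ℝ ^ n`. -/
def castVec {n : ℕ} (z : Fin n → ℤ) : Fin n → ℝ := fun i => z i

/-- The real vector `r` with the last entry `y` appended. -/
abbrev snoc {n : ℕ} (r : Fin n → ℝ) (y : ℝ) : Fin (n + 1) → ℝ := Fin.snoc r y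

section Hull

variable {n : ℕ} {u x : Fin n → ℤ} {S T : Set (Fin n → ℤ)}

theorem castVec_sub (x y : Fin n → ℤ) : castVec (x - y) = castVec x - castVec y := by
  ext i
  exact Int.cast_sub _ _

theorem castVec_mem_Icc (hx : x ∈ box u) : castVec x ∈ Icc 0 (castVec u) :=
  ⟨fun i => Int.cast_nonneg (hx i).1, fun i => Int.cast_le.2 (hx i).2⟩

theorem init_mem_Icc {x y z : Fin (n + 1) → ℝ} (hx : x ∈ Icc y z) :
    Fin.init x ∈ Icc (Fin.init y) (Fin.init z) :=
  ⟨fun i => hx.1 i.castSucc, fun i => hx.2 i.castSucc⟩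

theorem convex_conv (S : Set (Fin n → ℤ)) : Convex ℝ (conv S) := convex_convexHull ℝ _

theorem conv_mono (h : S ⊆ T) : conv S ⊆ conv T := convexHull_mono (image_mono h)

theorem conv_empty : conv (∅ : Set (Fin n → ℤ)) = ∅ := by simp [conv]

theorem castVec_mem_conv {z : Fin n → ℤ} (hz : z ∈ S) : castVec z ∈ conv S :=
  subset_convexHull ℝ _ ⟨z, hz, rfl⟩

theorem conv_subset {P : Set (Fin n → ℝ)} (hP : Convex ℝ P) (h : ∀ z ∈ S, castVec z ∈ P) :
    conv S ⊆ P :=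
  convexHull_min (image_subset_iff.2 h) hP

theorem isLinearMap_snoc : IsLinearMap ℝ fun p : (Fin n → ℝ) × ℝ => snoc p.1 p.2 where
  map_add p q := by ext i; induction i using Fin.lastCases <;> simp
  map_smul c p := by ext i; induction i using Fin.lastCases <;> simp

theorem snoc_mem_conv {T : Set (Fin (n + 1) → ℤ)} {k l : ℤ} {r : Fin n → ℝ} {y : ℝ}
    (hr : r ∈ conv S) (hy : y ∈ Icc (k : ℝ) l)
    (h : ∀ z : Fin (n + 1) → ℤ, Fin.init z ∈ S → z (Fin.last n) ∈ Icc k l → z ∈ T) :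
    snoc r y ∈ conv T := by
  have hkl : k ≤ l := Int.cast_le.1 (hy.1.trans hy.2)
  have hry : (r, y) ∈ convexHull ℝ ((castVec '' S) ×ˢ {(k : ℝ), (l : ℝ)}) := by
    rw [convexHull_prod, convexHull_pair, segment_eq_Icc (Int.cast_le.2 hkl)]
    exact ⟨hr, hy⟩
  have hvertex : ∀ z ∈ S, ∀ j ∈ Icc k l, snoc (castVec z) j ∈ conv T := by
    intro z hz j hj
    have hsnoc : snoc (castVec z) j = castVec (Fin.snoc (α := fun _ => ℤ) z j) := by
      ext i
      induction i using Fin.lastCases <;> simp [castVec]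
    exact hsnoc ▸ castVec_mem_conv (h _ (by simpa using hz) (by simpa using hj))
  refine convexHull_min ?_ ((convex_conv T).is_linear_preimage isLinearMap_snoc) hry
  rintro ⟨_, j⟩ ⟨⟨z, hz, rfl⟩, rfl | rfl⟩
  exacts [hvertex z hz k ⟨le_rfl, hkl⟩, hvertex z hz l ⟨hkl, le_rfl⟩]

theorem smul_add_smul_mem_smul {E : Type*} [AddCommGroup E] [Module ℝ E] {P : Set E}
    (hP : Convex ℝ P) {a α : ℝ} (ha : 0 ≤ a) (haα : a ≤ α) {p q : E} (hp : p ∈ P)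
    (hq : a ≠ α → q ∈ P) : a • p + (α - a) • q ∈ α • P := by
  rcases eq_or_ne a α with rfl | hne
  · simpa using smul_mem_smul_set hp
  · have h := add_mem_add (smul_mem_smul_set (a := a) hp)
      (smul_mem_smul_set (a := α - a) (hq hne))
    rwa [← hP.add_smul ha (sub_nonneg.2 haα), add_sub_cancel] at h

end Hull

/-! ### The linear system of a lexicographic segment -/

/-- The least mass that can stay tied with `θ` after one more entry has been read, if the mass `α`
was tied before. Here `u` and `θ` are the bounds of that entry and `x` is its value. A negative
result means that no mass has to stay tied; `max 0` is not taken in order to keep the weight affine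
in `α` and `x`. -/
noncomputable def tiedWeight (u θ : ℤ) (α x : ℝ) : ℝ :=
  if θ = 0 then α else x - u + α * (u - θ + 1)

/-- The system of `n` inequalities which describes, within the real box, the points that are
averages of the vectors below `θ`, with weight `α`, and of free vectors of the box, with weight
`1 - α`. The hull of `lexIic u θ` is the case `α = 1`. -/
def LexFeasible : {n : ℕ} → (u θ : Fin n → ℤ) → (α : ℝ) → (x : Fin n → ℝ) → Prop
  | 0, _, _, _, _ => True
  | n + 1, u, θ, α, x =>
    x (Fin.last n) ≤ u (Fin.last n) - α * (u (Fin.last n) - θ (Fin.last n)) ∧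
      LexFeasible (Fin.init u) (Fin.init θ)
        (tiedWeight (u (Fin.last n)) (θ (Fin.last n)) α (x (Fin.last n))) (Fin.init x)

/-- The polytope cut out of the real box by the systems of `θ` and, after the reflection
`x ↦ u - x` of the box, of `γ`. -/
def lexPolytope {n : ℕ} (u γ θ : Fin n → ℤ) : Set (Fin n → ℝ) :=
  {x ∈ Icc 0 (castVec u) | LexFeasible u θ 1 x ∧ LexFeasible u (u - γ) 1 (castVec u - x)}

section Necessity

variable {n : ℕ} {u γ θ : Fin n → ℤ} {α : ℝ} {x : Fin n → ℝ}

theorem lexFeasible_of_nonpos (hθ : θ ∈ box u) (hx : x ∈ Icc 0 (castVec u)) (hα : α ≤ 0) :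
    LexFeasible u θ α x := by
  induction n generalizing α with
  | zero => trivial
  | succ n ih =>
    have hθu : (θ (Fin.last n) : ℝ) ≤ u (Fin.last n) := Int.cast_le.2 (hθ _).2
    have hxu : x (Fin.last n) ≤ u (Fin.last n) := hx.2 _
    refine ⟨by nlinarith, ih (mem_box_succ_iff.1 hθ).1 (init_mem_Icc hx) ?_⟩
    unfold tiedWeight
    split_ifs
    · exact hα
    · nlinarith

theorem LexFeasible.max_zero (h : LexFeasible u θ α x) (hθ : θ ∈ box u)
    (hx : x ∈ Icc 0 (castVec u)) : LexFeasible u θ (max 0 α) x := by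
  rcases le_total 0 α with hα | hα
  · rwa [max_eq_right hα]
  · rw [max_eq_left hα]
    exact lexFeasible_of_nonpos hθ hx le_rfl

theorem lexFeasible_castVec {z : Fin n → ℤ} (hθ : θ ∈ box u) (hz : z ∈ lexIic u θ) (hα : α ≤ 1) :
    LexFeasible u θ α (castVec z) := by
  induction n generalizing α with
  | zero => trivial
  | succ n ih =>
    have hθu : (θ (Fin.last n) : ℝ) ≤ u (Fin.last n) := Int.cast_le.2 (hθ _).2
    have hθ' := (mem_box_succ_iff.1 hθ).1
    have hz' := (mem_box_succ_iff.1 hz.1).1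
    simp only [LexFeasible, castVec]
    rcases lexLE_succ_iff.1 hz.2 with hlt | ⟨heq, hle⟩
    · have hlt' : (z (Fin.last n) : ℝ) + 1 ≤ θ (Fin.last n) := by exact_mod_cast hlt
      have hne : θ (Fin.last n) ≠ 0 := ((hz.1 _).1.trans_lt hlt).ne'
      refine ⟨by nlinarith, lexFeasible_of_nonpos hθ' (castVec_mem_Icc hz') ?_⟩
      rw [tiedWeight, if_neg hne]
      nlinarith
    · rw [heq]
      refine ⟨by nlinarith, ih hθ' ⟨hz', hle⟩ ?_⟩
      unfold tiedWeight
      split_ifs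
      · exact hα
      · nlinarith

theorem exists_affineMap_lexFeasible_iff {E : Type*} [AddCommGroup E] [Module ℝ E]
    (u θ : Fin n → ℤ) (α : E →ᵃ[ℝ] ℝ) (g : Fin n → E →ᵃ[ℝ] ℝ) :
    ∃ f : Fin n → E →ᵃ[ℝ] ℝ, ∀ x,
      LexFeasible u θ (α x) (fun i => g i x) ↔ ∀ k, f k x ≤ 0 := by
  induction n generalizing α with
  | zero => exact ⟨g, fun x => iff_of_true trivial finZeroElim⟩
  | succ n ih =>
    set v : ℤ := u (Fin.last n)
    set k : ℤ := θ (Fin.last n)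
    obtain ⟨f, hf⟩ := ih (Fin.init u) (Fin.init θ)
      (if k = 0 then α else g (Fin.last n) - AffineMap.const ℝ E (v : ℝ) + (v - k + 1 : ℝ) • α)
      (Fin.init g)
    refine ⟨Fin.snoc (α := fun _ => E →ᵃ[ℝ] ℝ) f
      (g (Fin.last n) - (AffineMap.const ℝ E (v : ℝ) - (v - k : ℝ) • α)), fun x => ?_⟩
    rw [Fin.forall_fin_succ', LexFeasible, and_comm]
    refine and_congr ?_ (by simp [v, k, mul_comm])
    simp only [Fin.snoc_castSucc]
    rw [← hf x, tiedWeight]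
    refine iff_of_eq ?_
    congr 1
    split_ifs <;> simp [v, k, mul_comm]

theorem convex_setOf_lexFeasible {E : Type*} [AddCommGroup E] [Module ℝ E] (u θ : Fin n → ℤ)
    (g : Fin n → E →ᵃ[ℝ] ℝ) : Convex ℝ {x | LexFeasible u θ 1 fun i => g i x} := by
  obtain ⟨f, hf⟩ := exists_affineMap_lexFeasible_iff u θ (AffineMap.const ℝ E 1) g
  have hinter : {x | LexFeasible u θ 1 fun i => g i x} = ⋂ k, f k ⁻¹' Iic 0 := by
    ext x
    simpa using hf x
  rw [hinter]
  exact convex_iInter fun k => (convex_Iic 0).affine_preimage (f k)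

theorem conv_lexIic_subset (hθ : θ ∈ box u) :
    conv (lexIic u θ) ⊆ {x ∈ Icc 0 (castVec u) | LexFeasible u θ 1 x} :=
  conv_subset ((convex_Icc _ _).inter (convex_setOf_lexFeasible u θ (AffineMap.proj ·)))
    fun _ hz => ⟨castVec_mem_Icc hz.1, lexFeasible_castVec hθ hz le_rfl⟩

theorem conv_lexIci_subset (hγ : γ ∈ box u) :
    conv (lexIci u γ) ⊆ {x | LexFeasible u (u - γ) 1 (castVec u - x)} :=
  conv_subset (convex_setOf_lexFeasible u (u - γ)
      fun i => AffineMap.const ℝ (Fin n → ℝ) (castVec u i) - AffineMap.proj i) fun z hz => by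
    have h := lexFeasible_castVec (sub_mem_box_iff.2 hγ) (sub_mem_lexIic_sub_iff.2 hz) le_rfl
    rwa [castVec_sub] at h

theorem conv_lexIci_inter_conv_lexIic_subset (hγ : γ ∈ box u) (hθ : θ ∈ box u) :
    conv (lexIci u γ) ∩ conv (lexIic u θ) ⊆ lexPolytope u γ θ :=
  fun _ hx => ⟨(conv_lexIic_subset hθ hx.2).1, (conv_lexIic_subset hθ hx.2).2,
    conv_lexIci_subset hγ hx.1⟩

end Necessity

/-! ### Splitting the mass at one entry -/

section Splitting

variable {u γ θ : ℤ} {α β x : ℝ}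

theorem tiedWeight_le (hx : x ≤ u - α * (u - θ)) : tiedWeight u θ α x ≤ α := by
  unfold tiedWeight
  split_ifs
  · exact le_rfl
  · linarith

theorem le_add_of_tiedWeight_le {a : ℝ} (hx : x ≤ u - α * (u - θ)) (ha : tiedWeight u θ α x ≤ a) :
    x ≤ u - α * (u - θ + 1) + a := by
  unfold tiedWeight at ha
  split_ifs at ha <;> linarith

theorem tiedWeight_one_self (u θ : ℤ) : tiedWeight u θ 1 θ = 1 := by
  unfold tiedWeight
  split_ifs <;> ring

theorem le_splitting_upper (hθ : 0 ≤ θ) (hγ : γ ≤ u) (hu : 0 ≤ u) (hα : 0 ≤ α) (hαβ : α + β ≤ 1)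
    (hxθ : x ≤ u - α * (u - θ)) (hxγ : β * γ ≤ x) {a b : ℝ}
    (ha : a = max 0 (tiedWeight u θ α x)) (hb : b = max 0 (tiedWeight u (u - γ) β (u - x))) :
    x ≤ a * θ + (α - a) * (θ - 1) + b * γ + (β - b) * u + (1 - α - β) * u := by
  have hxa : x ≤ u - α * (u - θ + 1) + a :=
    le_add_of_tiedWeight_le hxθ (ha ▸ le_max_right _ _)
  have hγ' : (γ : ℝ) ≤ u := Int.cast_le.2 hγ
  have hu' : (0 : ℝ) ≤ u := Int.cast_nonneg hu
  suffices hsplit : b * (u - γ) ≤ u - α * (u - θ + 1) + a - x by linarith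
  rcases hγ.eq_or_lt with rfl | hlt
  · linarith
  have hlt' : (γ : ℝ) + 1 ≤ u := by exact_mod_cast hlt
  rw [tiedWeight, if_neg (sub_ne_zero.2 hlt.ne')] at hb
  push_cast at hb
  rcases max_cases 0 ((u : ℝ) - x - u + β * (u - (u - γ) + 1)) with ⟨hmax, -⟩ | ⟨hmax, -⟩
  · rw [hb, hmax]
    linarith
  · have hbβ : b ≤ β := by linarith
    have hfree : 0 ≤ a + α * (θ - 1) := by
      rcases hθ.eq_or_lt with rfl | hpos
      · rw [tiedWeight, if_pos rfl, max_eq_right hα] at ha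
        simp [ha]
      · have : (1 : ℝ) ≤ θ := by exact_mod_cast hpos
        have : 0 ≤ a := ha ▸ le_max_left _ _
        nlinarith
    nlinarith [mul_nonneg (sub_nonneg.2 hbβ) (sub_nonneg.2 hlt'),
      mul_nonneg (sub_nonneg.2 hαβ) hu']

theorem exists_splitting (hθ0 : 0 ≤ θ) (hθu : θ ≤ u) (hγu : γ ≤ u) (hα : 0 ≤ α)
    (hβ : 0 ≤ β) (hαβ : α + β ≤ 1) (hxθ : x ≤ u - α * (u - θ)) (hxγ : β * γ ≤ x) {a b : ℝ}
    (ha : a = max 0 (tiedWeight u θ α x)) (hb : b = max 0 (tiedWeight u (u - γ) β (u - x))) :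
    ∃ y₁ y₂ y₃ : ℝ,
      x = a * θ + (α - a) * y₁ + (b * γ + (β - b) * y₂) + (1 - α - β) * y₃ ∧
      (a ≠ α → y₁ ∈ Icc 0 (θ - 1 : ℝ)) ∧ (b ≠ β → y₂ ∈ Icc (γ + 1 : ℝ) u) ∧
      y₃ ∈ Icc 0 (u : ℝ) := by
  have hupper := le_splitting_upper hθ0 hγu (hθ0.trans hθu) hα hαβ hxθ hxγ ha hb
  have hlower := le_splitting_upper (θ := u - γ) (γ := u - θ) (β := α) (x := u - x)
    (sub_nonneg.2 hγu) (sub_le_self u hθ0) (hθ0.trans hθu) hβ (by linarith) (by push_cast; linarith)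
    (by push_cast; linarith) hb (by simpa using ha)
  push_cast at hlower
  have hθ' : a ≠ α → (0 : ℝ) ≤ θ - 1 := by
    intro hne
    have hθ : θ ≠ 0 := fun h => hne (by rw [ha, tiedWeight, if_pos h, max_eq_right hα])
    exact_mod_cast Int.sub_nonneg_of_le (hθ0.lt_of_ne' hθ)
  have hγ' : b ≠ β → (γ + 1 : ℝ) ≤ u := by
    intro hne
    have hγ : u - γ ≠ 0 := fun h => hne (by rw [hb, tiedWeight, if_pos h, max_eq_right hβ])
    exact_mod_cast hγu.lt_of_ne' (sub_ne_zero.1 hγ)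
  have hu : (0 : ℝ) ≤ u := Int.cast_nonneg (hθ0.trans hθu)
  set lower : ℝ := b * γ + (β - b) * (γ + 1) + a * θ
  set upper : ℝ := a * θ + (α - a) * (θ - 1) + b * γ + (β - b) * u + (1 - α - β) * u
  obtain ⟨s, t, hs, ht, hst, hx⟩ : x ∈ segment ℝ lower upper := by
    have hmem : x ∈ Icc lower upper := ⟨by linarith, hupper⟩
    rwa [segment_eq_Icc (hmem.1.trans hmem.2)]
  refine ⟨s • 0 + t • (θ - 1), s • (γ + 1) + t • u, s • 0 + t • u, ?_,
    fun hne => convex_Icc _ _ (left_mem_Icc.2 (hθ' hne)) (right_mem_Icc.2 (hθ' hne)) hs ht hst,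
    fun hne => convex_Icc _ _ (left_mem_Icc.2 (hγ' hne)) (right_mem_Icc.2 (hγ' hne)) hs ht hst,
    convex_Icc _ _ (left_mem_Icc.2 hu) (right_mem_Icc.2 hu) hs ht hst⟩
  simp only [smul_eq_mul, lower, upper] at hx ⊢
  linear_combination -hx + (a * θ + b * γ) * hst

theorem exists_splitting_of_lt (hlt : γ < θ) (hx : x ∈ Icc (γ : ℝ) θ) {a b : ℝ}
    (ha : a = max 0 (x - θ + 1)) (hb : b = max 0 (γ + 1 - x)) :
    a + b ≤ 1 ∧ ∃ y : ℝ, x = a * θ + b * γ + (1 - (a + b)) * y ∧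
      (a + b ≠ 1 → y ∈ Icc (γ + 1 : ℝ) (θ - 1)) := by
  rcases (Int.add_one_le_of_lt hlt).eq_or_lt with rfl | hlt'
  · push_cast at hx ha ⊢
    have hx1 := hx.1
    have hx2 := hx.2
    rw [max_eq_right (by linarith)] at ha hb
    subst ha hb
    exact ⟨by linarith, 0, by ring, fun h => absurd (by ring) h⟩
  have hθγ : (γ : ℝ) + 2 ≤ θ := by exact_mod_cast (by omega : γ + 2 ≤ θ)
  have hx1 := hx.1
  have hx2 := hx.2
  rcases le_total x (γ + 1) with hleft | hleft
  · rw [max_eq_left (by linarith)] at ha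
    rw [max_eq_right (by linarith)] at hb
    subst ha hb
    exact ⟨by linarith, γ + 1, by ring, fun _ => ⟨le_rfl, by linarith⟩⟩
  rw [max_eq_left (by linarith)] at hb
  rcases le_total x (θ - 1) with hright | hright
  · rw [max_eq_left (by linarith)] at ha
    subst ha hb
    exact ⟨by norm_num, x, by ring, fun _ => ⟨hleft, hright⟩⟩
  · rw [max_eq_right (by linarith)] at ha
    subst ha hb
    exact ⟨by linarith, θ - 1, by ring, fun _ => ⟨by linarith, le_rfl⟩⟩

end Splitting

/-! ### Sufficiency of the linear system -/

section Sufficiency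

variable {n : ℕ}

theorem snoc_mem_smul_conv_lexIic {u θ : Fin (n + 1) → ℤ} (hθ : θ ∈ box u) {a α y : ℝ}
    (ha : 0 ≤ a) (haα : a ≤ α) {p r : Fin n → ℝ}
    (hp : p ∈ conv (lexIic (Fin.init u) (Fin.init θ))) (hr : r ∈ conv (box (Fin.init u)))
    (hy : a ≠ α → y ∈ Icc 0 (θ (Fin.last n) - 1 : ℝ)) :
    a • snoc p (θ (Fin.last n)) + (α - a) • snoc r y ∈ α • conv (lexIic u θ) := by
  refine smul_add_smul_mem_smul (convex_conv _) ha haα ?_ fun hne => ?_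
  · exact snoc_mem_conv hp ⟨le_rfl, le_rfl⟩ fun z hz hlast =>
      mem_lexIic_of_last_eq hθ hz (le_antisymm hlast.2 hlast.1)
  · refine snoc_mem_conv (k := 0) (l := θ (Fin.last n) - 1) hr (by exact_mod_cast hy hne) ?_
    exact fun z hz hlast => mem_lexIic_of_last_lt hθ hz hlast.1 (Int.lt_of_le_sub_one hlast.2)

theorem snoc_mem_smul_conv_lexIci {u γ : Fin (n + 1) → ℤ} (hγ : γ ∈ box u) {b β y : ℝ}
    (hb : 0 ≤ b) (hbβ : b ≤ β) {q r : Fin n → ℝ}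
    (hq : q ∈ conv (lexIci (Fin.init u) (Fin.init γ))) (hr : r ∈ conv (box (Fin.init u)))
    (hy : b ≠ β → y ∈ Icc (γ (Fin.last n) + 1 : ℝ) (u (Fin.last n))) :
    b • snoc q (γ (Fin.last n)) + (β - b) • snoc r y ∈ β • conv (lexIci u γ) := by
  refine smul_add_smul_mem_smul (convex_conv _) hb hbβ ?_ fun hne => ?_
  · exact snoc_mem_conv hq ⟨le_rfl, le_rfl⟩ fun z hz hlast =>
      mem_lexIci_of_last_eq hγ hz (le_antisymm hlast.2 hlast.1)
  · refine snoc_mem_conv (k := γ (Fin.last n) + 1) hr (by exact_mod_cast hy hne) ?_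
    exact fun z hz hlast => mem_lexIci_of_lt_last hγ hz (Int.lt_of_add_one_le hlast.1) hlast.2

theorem snoc_mem_conv_box {u : Fin (n + 1) → ℤ} {r : Fin n → ℝ} {y : ℝ}
    (hr : r ∈ conv (box (Fin.init u))) (hy : y ∈ Icc 0 (u (Fin.last n) : ℝ)) :
    snoc r y ∈ conv (box u) :=
  snoc_mem_conv (k := 0) hr (by exact_mod_cast hy) fun _ hz hlast =>
    mem_box_succ_iff.2 ⟨hz, hlast⟩

theorem mem_add_of_lexFeasible {u γ θ : Fin n → ℤ} (hγ : γ ∈ box u) (hθ : θ ∈ box u)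
    {x : Fin n → ℝ} (hx : x ∈ Icc 0 (castVec u)) {α β : ℝ} (hα : 0 ≤ α) (hβ : 0 ≤ β)
    (hαβ : α + β ≤ 1) (hfeasθ : LexFeasible u θ α x)
    (hfeasγ : LexFeasible u (u - γ) β (castVec u - x)) :
    x ∈ α • conv (lexIic u θ) + β • conv (lexIci u γ) + (1 - α - β) • conv (box u) := by
  induction n generalizing α β with
  | zero =>
    have hIic : (conv (lexIic u θ)).Nonempty := ⟨_, castVec_mem_conv ⟨hθ, LexLE.refl θ⟩⟩
    have hIci : (conv (lexIci u γ)).Nonempty := ⟨_, castVec_mem_conv ⟨hγ, LexLE.refl γ⟩⟩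
    have hbox : (conv (box u)).Nonempty := ⟨_, castVec_mem_conv hθ⟩
    exact Subsingleton.mem_iff_nonempty.2 ((hIic.smul_set.add hIci.smul_set).add hbox.smul_set)
  | succ n ih =>
    obtain ⟨hlastθ, hinitθ⟩ := hfeasθ
    obtain ⟨hlastγ, hinitγ⟩ := hfeasγ
    have hθ' := mem_box_succ_iff.1 hθ
    have hγ' := mem_box_succ_iff.1 hγ
    have hx' := init_mem_Icc hx
    replace hinitθ := hinitθ.max_zero hθ'.1 hx'
    replace hinitγ := hinitγ.max_zero (sub_mem_box_iff.2 hγ'.1) (sub_mem_Icc_zero_iff_right.2 hx')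
    have haα := max_le hα (tiedWeight_le hlastθ)
    have hbβ := max_le hβ (tiedWeight_le hlastγ)
    have ha := le_max_left 0 (tiedWeight (u (Fin.last n)) (θ (Fin.last n)) α (x (Fin.last n)))
    have hb := le_max_left 0
      (tiedWeight (u (Fin.last n)) ((u - γ) (Fin.last n)) β ((castVec u - x) (Fin.last n)))
    simp only [Pi.sub_apply, castVec, Int.cast_sub] at hlastγ
    obtain ⟨y₁, y₂, y₃, hlast, hy₁, hy₂, hy₃⟩ := exists_splitting hθ'.2.1 hθ'.2.2 hγ'.2.2
      hα hβ hαβ hlastθ (by linarith) rfl rfl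
    obtain ⟨_, ⟨_, ⟨p, hp, rfl⟩, _, ⟨q, hq, rfl⟩, rfl⟩, _, ⟨r, hr, rfl⟩, hinit⟩ :=
      ih hγ'.1 hθ'.1 hx' ha hb (by linarith) hinitθ hinitγ
    refine ⟨_, ⟨_, snoc_mem_smul_conv_lexIic hθ ha haα hp hr hy₁,
      _, snoc_mem_smul_conv_lexIci hγ hb hbβ hq hr hy₂, rfl⟩,
      _, smul_mem_smul_set (snoc_mem_conv_box hr hy₃), ?_⟩
    ext i
    induction i using Fin.lastCases with
    | last => simpa [castVec] using hlast.symm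
    | cast i =>
      have hi := congrFun hinit i
      simp only [Pi.add_apply, Pi.smul_apply, smul_eq_mul, Fin.init, Fin.snoc_castSucc] at hi ⊢
      linear_combination hi

theorem snoc_mem_conv_lexIcc {u γ θ : Fin (n + 1) → ℤ} (hγ : γ ∈ box u) (hθ : θ ∈ box u)
    (hlt : γ (Fin.last n) < θ (Fin.last n)) {a b y : ℝ} (ha : 0 ≤ a) (hb : 0 ≤ b)
    (hab : a + b ≤ 1) {p q r : Fin n → ℝ} (hp : p ∈ conv (lexIic (Fin.init u) (Fin.init θ)))
    (hq : q ∈ conv (lexIci (Fin.init u) (Fin.init γ))) (hr : r ∈ conv (box (Fin.init u)))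
    (hy : a + b ≠ 1 → y ∈ Icc (γ (Fin.last n) + 1 : ℝ) (θ (Fin.last n) - 1)) :
    a • snoc p (θ (Fin.last n)) + b • snoc q (γ (Fin.last n)) + (1 - (a + b)) • snoc r y ∈
      conv (lexIcc u γ θ) := by
  have hp' : snoc p (θ (Fin.last n)) ∈ conv (lexIcc u γ θ) :=
    snoc_mem_conv hp ⟨le_rfl, le_rfl⟩ fun z hz hlast =>
      have hzθ := mem_lexIic_of_last_eq hθ hz (le_antisymm hlast.2 hlast.1)
      ⟨hzθ.1, lexLE_succ_iff.2 (Or.inl (hlt.trans_le hlast.1)), hzθ.2⟩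
  have hq' : snoc q (γ (Fin.last n)) ∈ conv (lexIcc u γ θ) :=
    snoc_mem_conv hq ⟨le_rfl, le_rfl⟩ fun z hz hlast =>
      have hzγ := mem_lexIci_of_last_eq hγ hz (le_antisymm hlast.2 hlast.1)
      ⟨hzγ.1, hzγ.2, lexLE_succ_iff.2 (Or.inl (hlast.2.trans_lt hlt))⟩
  have hr' : a + b ≠ 1 → snoc r y ∈ conv (lexIcc u γ θ) := fun hne =>
    snoc_mem_conv (k := γ (Fin.last n) + 1) (l := θ (Fin.last n) - 1) hr
      (by exact_mod_cast hy hne) fun z hz hlast =>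
        have hzθ := mem_lexIic_of_last_lt hθ hz ((hγ _).1.trans (Int.le_of_lt hlast.1))
          (Int.lt_of_le_sub_one hlast.2)
        ⟨hzθ.1, lexLE_succ_iff.2 (Or.inl (Int.lt_of_add_one_le hlast.1)), hzθ.2⟩
  obtain ⟨c, hc, hpq⟩ : a • snoc p (θ (Fin.last n)) + b • snoc q (γ (Fin.last n)) ∈
      (a + b) • conv (lexIcc u γ θ) := by
    simpa using smul_add_smul_mem_smul (convex_conv _) ha (le_add_of_nonneg_right hb) hp'
      fun _ => hq'
  rw [← hpq, ← one_smul ℝ (conv _)]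
  exact smul_add_smul_mem_smul (convex_conv _) (add_nonneg ha hb) hab hc hr'

theorem mem_conv_lexIcc_of_last_lt {u γ θ : Fin (n + 1) → ℤ} (hγ : γ ∈ box u) (hθ : θ ∈ box u)
    (hlt : γ (Fin.last n) < θ (Fin.last n)) {x : Fin (n + 1) → ℝ} (hx : x ∈ lexPolytope u γ θ)
    (hlast : x (Fin.last n) ∈ Icc (γ (Fin.last n) : ℝ) (θ (Fin.last n))) :
    x ∈ conv (lexIcc u γ θ) := by
  obtain ⟨hxu, ⟨-, hinitθ⟩, ⟨-, hinitγ⟩⟩ := hx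
  have hθ' := (mem_box_succ_iff.1 hθ).1
  have hγ' := (mem_box_succ_iff.1 hγ).1
  have hx' := init_mem_Icc hxu
  replace hinitθ := hinitθ.max_zero hθ' hx'
  replace hinitγ := hinitγ.max_zero (sub_mem_box_iff.2 hγ') (sub_mem_Icc_zero_iff_right.2 hx')
  have hθ0 : θ (Fin.last n) ≠ 0 := ((hγ _).1.trans_lt hlt).ne'
  have hγu : (u - γ) (Fin.last n) ≠ 0 := sub_ne_zero.2 (hlt.trans_le (hθ _).2).ne'
  rw [tiedWeight, if_neg hθ0] at hinitθ
  rw [tiedWeight, if_neg hγu] at hinitγ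
  have ha := le_max_left 0
    (x (Fin.last n) - u (Fin.last n) + 1 * (u (Fin.last n) - θ (Fin.last n) + 1))
  have hb := le_max_left 0 ((castVec u - x) (Fin.last n) - u (Fin.last n)
    + 1 * (u (Fin.last n) - ((u - γ) (Fin.last n) : ℤ) + 1))
  obtain ⟨hab, y, hxy, hy⟩ := exists_splitting_of_lt hlt hlast
    (a := max 0 (x (Fin.last n) - u (Fin.last n) + 1 * (u (Fin.last n) - θ (Fin.last n) + 1)))
    (b := max 0 ((castVec u - x) (Fin.last n) - u (Fin.last n)
      + 1 * (u (Fin.last n) - ((u - γ) (Fin.last n) : ℤ) + 1)))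
    (by ring_nf) (by simp only [castVec, Pi.sub_apply, Int.cast_sub]; ring_nf)
  obtain ⟨_, ⟨_, ⟨p, hp, rfl⟩, _, ⟨q, hq, rfl⟩, rfl⟩, _, ⟨r, hr, rfl⟩, hinit⟩ :=
    mem_add_of_lexFeasible hγ' hθ' hx' ha hb hab hinitθ hinitγ
  convert snoc_mem_conv_lexIcc hγ hθ hlt ha hb hab hp hq hr hy using 1
  ext i
  induction i using Fin.lastCases with
  | last => simpa using hxy
  | cast i =>
    have hi := congrFun hinit i
    simp only [Pi.add_apply, Pi.smul_apply, smul_eq_mul, Fin.init, Fin.snoc_castSucc] at hi ⊢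
    linear_combination -hi

theorem lexPolytope_subset_conv {u γ θ : Fin n → ℤ} (hγ : γ ∈ box u) (hθ : θ ∈ box u) :
    lexPolytope u γ θ ⊆ conv (lexIcc u γ θ) := by
  induction n with
  | zero =>
    intro x _
    rw [Subsingleton.elim x (castVec θ)]
    exact castVec_mem_conv ⟨hθ, Subsingleton.elim θ γ ▸ LexLE.refl θ, LexLE.refl θ⟩
  | succ n ih =>
    intro x hx
    obtain ⟨hxu, ⟨hlastθ, hinitθ⟩, ⟨hlastγ, hinitγ⟩⟩ := id hx
    simp only [castVec, Pi.sub_apply, Int.cast_sub] at hlastγ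
    have hlast : x (Fin.last n) ∈ Icc (γ (Fin.last n) : ℝ) (θ (Fin.last n)) :=
      ⟨by linarith, by linarith⟩
    rcases (Int.cast_le.1 (hlast.1.trans hlast.2)).lt_or_eq with hlt | heq
    · exact mem_conv_lexIcc_of_last_lt hγ hθ hlt hx hlast
    have hxγ : x (Fin.last n) = γ (Fin.last n) :=
      le_antisymm (hlast.2.trans (Int.cast_le.2 heq.ge)) hlast.1
    have hxθ : x (Fin.last n) = θ (Fin.last n) := by rw [hxγ, heq]
    have hxγ' : (castVec u - x) (Fin.last n) = ((u - γ) (Fin.last n) : ℤ) := by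
      simp [castVec, hxγ]
    rw [hxθ, tiedWeight_one_self] at hinitθ
    rw [hxγ', tiedWeight_one_self] at hinitγ
    rw [← Fin.snoc_init_self x]
    refine snoc_mem_conv (ih (mem_box_succ_iff.1 hγ).1 (mem_box_succ_iff.1 hθ).1
      ⟨init_mem_Icc hxu, hinitθ, hinitγ⟩) hlast fun z hz hzlast => ?_
    have hzγ : z (Fin.last n) = γ (Fin.last n) :=
      le_antisymm (hzlast.2.trans heq.ge) hzlast.1
    have hzθ := mem_lexIic_of_last_eq hθ ⟨hz.1, hz.2.2⟩ (hzγ.trans heq)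
    exact ⟨hzθ.1, (mem_lexIci_of_last_eq hγ ⟨hz.1, hz.2.1⟩ hzγ).2, hzθ.2⟩

end Sufficiency

section Interval

variable {n : ℕ} {u γ θ : Fin n → ℤ}

theorem conv_lexIcc_subset (u γ θ : Fin n → ℤ) :
    conv (lexIcc u γ θ) ⊆ conv (lexIci u γ) ∩ conv (lexIic u θ) :=
  subset_inter (conv_mono fun _ h => ⟨h.1, h.2.1⟩) (conv_mono fun _ h => ⟨h.1, h.2.2⟩)

theorem conv_lexIcc_eq_inter (hγ : γ ∈ box u) (hθ : θ ∈ box u) :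
    conv (lexIcc u γ θ) = conv (lexIci u γ) ∩ conv (lexIic u θ) :=
  (conv_lexIcc_subset u γ θ).antisymm <|
    (conv_lexIci_inter_conv_lexIic_subset hγ hθ).trans (lexPolytope_subset_conv hγ hθ)

theorem conv_lexIcc_eq_lexPolytope (hγ : γ ∈ box u) (hθ : θ ∈ box u) :
    conv (lexIcc u γ θ) = lexPolytope u γ θ :=
  ((conv_lexIcc_subset u γ θ).trans (conv_lexIci_inter_conv_lexIic_subset hγ hθ)).antisymm
    (lexPolytope_subset_conv hγ hθ)

end Interval

/-! ### The number of inequalities -/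

section DescribedBy

variable {n : ℕ}

theorem DescribedBy.mono {N M : ℕ} {P : Set (Fin n → ℝ)} (h : DescribedBy P N) (hNM : N ≤ M) :
    DescribedBy P M := by
  obtain ⟨m, hm, h⟩ := h
  exact ⟨m, hm.trans hNM, h⟩

theorem describedBy_empty : DescribedBy (∅ : Set (Fin n → ℝ)) 1 :=
  ⟨1, le_rfl, 0, fun _ => -1, by ext x; simp⟩

theorem affineMap_apply_eq_dotProduct_add (f : (Fin n → ℝ) →ᵃ[ℝ] ℝ) (x : Fin n → ℝ) :
    f x = (fun i => f.linear (Pi.single i 1)) ⬝ᵥ x + f 0 := by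
  rw [congrFun f.decomp x, Pi.add_apply, LinearMap.pi_apply_eq_sum_univ f.linear x, dotProduct]
  congr 1
  refine Finset.sum_congr rfl fun i _ => ?_
  rw [smul_eq_mul, mul_comm]
  congr 2
  ext j
  simp only [Pi.single_apply, eq_comm]

theorem describedBy_setOf_forall_affineMap_nonpos {ι : Type*} [Fintype ι]
    (f : ι → (Fin n → ℝ) →ᵃ[ℝ] ℝ) : DescribedBy {x | ∀ k, f k x ≤ 0} (Fintype.card ι) := by
  let e := Fintype.equivFin ι
  refine ⟨_, le_rfl, fun k i => (f (e.symm k)).linear (Pi.single i 1),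
    fun k => -f (e.symm k) 0, ?_⟩
  ext x
  simp only [mem_ofPred_eq, le_neg_iff_add_nonpos_right, ← affineMap_apply_eq_dotProduct_add,
    e.symm.forall_congr_left, Equiv.symm_symm, Equiv.symm_apply_apply]

theorem describedBy_lexPolytope (u γ θ : Fin n → ℤ) : DescribedBy (lexPolytope u γ θ) (4 * n) := by
  let coord (i : Fin n) : (Fin n → ℝ) →ᵃ[ℝ] ℝ := AffineMap.proj i
  let cocoord (i : Fin n) : (Fin n → ℝ) →ᵃ[ℝ] ℝ := AffineMap.const ℝ _ (castVec u i) - coord i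
  obtain ⟨f, hf⟩ := exists_affineMap_lexFeasible_iff u θ (AffineMap.const ℝ _ 1) coord
  obtain ⟨g, hg⟩ := exists_affineMap_lexFeasible_iff u (u - γ) (AffineMap.const ℝ _ 1) cocoord
  have hpoly : lexPolytope u γ θ =
      {x | ∀ k, Sum.elim (Sum.elim (-coord) (-cocoord)) (Sum.elim f g) k x ≤ 0} := by
    ext x
    simp only [mem_ofPred_eq, Sum.forall, Sum.elim_inl, Sum.elim_inr, ← hf, ← hg]
    refine and_congr ?_ Iff.rfl
    simp [coord, cocoord, Pi.le_def, castVec]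
  rw [hpoly]
  refine (describedBy_setOf_forall_affineMap_nonpos _).mono ?_
  simp only [Fintype.card_sum, Fintype.card_fin]
  omega

theorem describedBy_conv_of_lexConvex (hn : 0 < n) {u : Fin n → ℤ} {S : Set (Fin n → ℤ)}
    (hS : S ⊆ box u)
    (hconv : ∀ x ∈ S, ∀ y ∈ S, ∀ z ∈ box u, LexLE x z → LexLE z y → z ∈ S) :
    DescribedBy (conv S) (4 * n) := by
  rcases S.eq_empty_or_nonempty with rfl | hne
  · rw [conv_empty]
    exact describedBy_empty.mono (by omega)
  · obtain ⟨γ, hγ, θ, hθ, rfl⟩ := exists_eq_lexIcc hS hne hconv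
    rw [conv_lexIcc_eq_lexPolytope hγ hθ]
    exact describedBy_lexPolytope u γ θ

end DescribedBy

/-! ### Intersections of knapsacks -/

section Intersection

variable {n : ℕ} {u : Fin n → ℤ}

theorem conv_knapsackLE_inter_knapsackGE {a w : Fin n → ℤ} {b d : ℤ} (hn : 0 < n)
    (ha : ∀ i, 0 < a i) (hw : ∀ i, 0 < w i) (hsa : Superincreasing a u)
    (hsw : Superincreasing w u) :
    conv (knapsackLE a u b ∩ knapsackGE w u d) =
      conv (knapsackLE a u b) ∩ conv (knapsackGE w u d) := by
  rcases (knapsackLE a u b).eq_empty_or_nonempty with hLE | hLE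
  · simp only [hLE, empty_inter, conv_empty]
  rcases (knapsackGE w u d).eq_empty_or_nonempty with hGE | hGE
  · simp only [hGE, inter_empty, conv_empty]
  have hinter : lexIci u (minPacking w u d) ∩ lexIic u (greedy a u b) =
      lexIcc u (minPacking w u d) (greedy a u b) :=
    ext fun _ => and_and_and_comm.trans (and_congr_left' and_self_iff)
  rw [inter_comm, inter_comm (conv _), knapsackLE_eq_lexIic hn ha hsa,
    knapsackGE_eq_lexIci hn hw hsw, hinter,
    conv_lexIcc_eq_inter (minPacking_mem_box_of_nonempty hw hGE)
      (greedy_mem_box_of_nonempty ha hLE)]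

theorem describedBy_conv_iInter_knapsack {ι κ : Type*} [Nonempty (ι ⊕ κ)] {a : ι → Fin n → ℤ}
    {b : ι → ℤ} {w : κ → Fin n → ℤ} {d : κ → ℤ} (hn : 0 < n) (ha : ∀ s i, 0 < a s i)
    (hw : ∀ t i, 0 < w t i) (hsa : ∀ s, Superincreasing (a s) u)
    (hsw : ∀ t, Superincreasing (w t) u) :
    DescribedBy (conv ((⋂ s, knapsackLE (a s) u (b s)) ∩ ⋂ t, knapsackGE (w t) u (d t)))
      (4 * n) := by
  refine describedBy_conv_of_lexConvex hn (u := u) ?_ ?_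
  · rintro x ⟨hLE, hGE⟩
    obtain ⟨s | t⟩ := ‹Nonempty (ι ⊕ κ)›
    · exact (mem_iInter.1 hLE s).1
    · exact (mem_iInter.1 hGE t).1
  · simp only [knapsackLE_eq_lexIic hn (ha _) (hsa _), knapsackGE_eq_lexIci hn (hw _) (hsw _)]
    rintro x ⟨-, hx⟩ y ⟨hy, -⟩ z hz hxz hzy
    exact ⟨mem_iInter.2 fun s => ⟨hz, hzy.trans (mem_iInter.1 hy s).2⟩,
      mem_iInter.2 fun t => ⟨hz, (mem_iInter.1 hx t).2.trans hxz⟩⟩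

end Intersection

end SuperincreasingKnapsack

open SuperincreasingKnapsack in
theorem theorem2_general {n : ℕ} (u : Fin n → ℤ) :
    (∀ γ ∈ box u, ∀ θ ∈ box u,
      conv {x ∈ box u | LexLE γ x ∧ LexLE x θ} =
        conv {x ∈ box u | LexLE γ x} ∩ conv {x ∈ box u | LexLE x θ}) ∧
    (∀ (a w : Fin n → ℤ) (b d : ℤ), 0 < n → (∀ i, 0 < a i) → (∀ i, 0 < w i) →
      Superincreasing a u → Superincreasing w u →
        knapsackLE a u b = {x ∈ box u | LexLE x (greedy a u b)} ∧
        knapsackGE w u d = {x ∈ box u | LexLE (minPacking w u d) x} ∧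
        conv (knapsackLE a u b ∩ knapsackGE w u d) =
          conv (knapsackLE a u b) ∩ conv (knapsackGE w u d)) ∧
    (∀ (ι κ : Type*) (a : ι → Fin n → ℤ) (b : ι → ℤ) (w : κ → Fin n → ℤ) (d : κ → ℤ),
      0 < n → Nonempty (ι ⊕ κ) →
      (∀ s, (∀ i, 0 < a s i) ∧ Superincreasing (a s) u) →
      (∀ t, (∀ i, 0 < w t i) ∧ Superincreasing (w t) u) →
        DescribedBy
          (conv ((⋂ s, knapsackLE (a s) u (b s)) ∩ ⋂ t, knapsackGE (w t) u (d t)))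
          (4 * n)) :=
  ⟨fun _ hγ _ hθ => conv_lexIcc_eq_inter hγ hθ,
    fun _ _ _ _ hn ha hw hsa hsw =>
      ⟨knapsackLE_eq_lexIic hn ha hsa, knapsackGE_eq_lexIci hn hw hsw,
        conv_knapsackLE_inter_knapsackGE hn ha hw hsa hsw⟩,
    fun _ _ _ _ _ _ hn _ ha hw => describedBy_conv_iInter_knapsack hn (fun s => (ha s).1)
      (fun t => (hw t).1) (fun s => (ha s).2) fun t => (hw t).2⟩

open SuperincreasingKnapsack in
theorem theorem2 :
    -- for any two vectors of the box
    (∀ (n : ℕ) (u γ θ : Fin n → ℤ), 0 < n → (∀ i, 0 < u i) → γ ∈ box u → θ ∈ box u →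
      conv {x ∈ box u | LexLE γ x ∧ LexLE x θ} =
        conv {x ∈ box u | LexLE γ x} ∩ conv {x ∈ box u | LexLE x θ}) ∧
    -- for two superincreasing knapsacks, with their maximal and minimal packings
    (∀ (n : ℕ) (u a w : Fin n → ℤ) (b d : ℤ), 0 < n → (∀ i, 0 < u i) →
      (∀ i, 0 < a i) → (∀ i, 0 < w i) → 0 < b → 0 < d →
      Superincreasing a u → Superincreasing w u →
        knapsackLE a u b = {x ∈ box u | LexLE x (greedy a u b)} ∧
        knapsackGE w u d = {x ∈ box u | LexLE (minPacking w u d) x} ∧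
        conv (knapsackLE a u b ∩ knapsackGE w u d) =
          conv (knapsackLE a u b) ∩ conv (knapsackGE w u d)) ∧
    -- for finitely many superincreasing knapsacks, at most `C * n` inequalities suffice
    (∃ C : ℕ, ∀ (n : ℕ) (u : Fin n → ℤ) (p q : ℕ)
      (a : Fin p → Fin n → ℤ) (b : Fin p → ℤ) (w : Fin q → Fin n → ℤ) (d : Fin q → ℤ),
      0 < n → 0 < p + q → (∀ i, 0 < u i) →
      (∀ s, (∀ i, 0 < a s i) ∧ 0 < b s ∧ Superincreasing (a s) u) →
      (∀ t, (∀ i, 0 < w t i) ∧ 0 < d t ∧ Superincreasing (w t) u) →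
        DescribedBy
          (conv ((⋂ s, knapsackLE (a s) u (b s)) ∩ ⋂ t, knapsackGE (w t) u (d t)))
          (C * n)) :=
  ⟨fun _ u γ θ _ _ hγ hθ => (theorem2_general.{0, 0} u).1 γ hγ θ hθ,
    fun _ u a w b d hn _ ha hw _ _ => (theorem2_general.{0, 0} u).2.1 a w b d hn ha hw,
    4, fun _ u p q a b w d hn hpq _ ha hw => (theorem2_general u).2.2 (Fin p) (Fin q) a b w d hn
      (Fintype.card_pos_iff.1 (by simpa using hpq)) (fun s => ⟨(ha s).1, (ha s).2.2⟩)
      fun t => ⟨(hw t).1, (hw t).2.2⟩⟩
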